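/- Let $\mathbb S^2=\{\xi\in\mathbb R^3:\|\xi\|=1\}$, $\mathbb I=[-1,1]$ with the distance $|x-y|$, and $\mathbb T=\mathbb R/2\pi\mathbb Z$ with the distance $d(x,y)=\min_{k\in\mathbb Z}|x-y+2\pi k|$. For a compact metric space $(\mathbb X,d)$, $1\le p<\infty$ and Borel probability measures $\mu,\nu$ on $\mathbb X$ let $$W_p^p(\mu,\nu)=\inf_{\pi\in\Pi(\mu,\nu)}\int_{\mathbb X\times\mathbb X} d(x,y)^p\,\mathrm d\pi(x,y),$$ where $\Pi(\mu,\nu)$ is the set of probability measures on $\mathbb X\times\mathbb X$ with marginals $\mu$ and $\nu$. For $\psi\in\mathbb T$ let $\mathcal V_\psi\mu=(\mathcal S_\psi)_\#\mu$ be the push-forward of $\mu$ under $\mathcal S_\psi\colon\mathbb S^2\to\mathbb I$, $\mathcal S_\psi(\xi)=\xi_1\cos\psi+\xi_2\sin\psi$. Write $\Phi(\varphi,\vartheta)=(\cos\varphi\sin\vartheta,\sin\varphi\sin\vartheta,\cos\vartheta)$ for $\varphi\in\mathbb T$, $\vartheta\in[0,\pi]$, let $\mathrm{azi}(\xi)\in\mathbb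 T$ be the azimuth of $\xi\in\mathbb S^2$ (that is, $\xi=\Phi(\mathrm{azi}(\xi),\vartheta)$ for some $\vartheta$, with $\mathrm{azi}(\xi)=0$ at the two poles $(0,0,\pm1)$), and let $\sigma_{\mathbb S^2}$ be the surface measure, $\int f\,\mathrm d\sigma_{\mathbb S^2}=\int_0^\pi\int_{\mathbb T} f(\Phi(\varphi,\vartheta))\sin\vartheta\,\mathrm d\varphi\,\mathrm d\vartheta$. For a zenith $\Phi(\alpha,\beta)$ let $\mathcal W_{\alpha,\beta}\mu=(\mathcal A_{\alpha,\beta})_\#\mu$ be the push-forward of $\mu$ under $\mathcal A_{\alpha,\beta}\colon\mathbb S^2\to\mathbb T$, $\mathcal A_{\alpha,\beta}(\xi)=\mathrm{azi}\big((R_3(\alpha)R_2(\beta))^\top\xi\big)$, where $$R_3(\alpha)=\begin{pmatrix}\cos\alpha&-\sin\alpha&0\\ \sin\alpha&\cos\alpha&0\\0&0&1\end{pmatrix},\qquad R_2(\beta)=\begin{pmatrix}\cos\beta&0&\sin\beta\\0&1&0\\-\sin\beta&0&\cos\beta\end{pmatrix};$$ here $\alpha=0$ is used if the zenith is a pole.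 **Theorem.** Let $1\le p<\infty$. For all Borel probability measures $\mu,\nu$ on $\mathbb S^2$ the integrands in $$\mathrm{VSW}_p^p(\mu,\nu)=\int_{\mathbb T}W_p^p(\mathcal V_\psi\mu,\mathcal V_\psi\nu)\,\mathrm d\psi,\qquad \mathrm{SSW}_p^p(\mu,\nu)=\int_{\mathbb S^2}W_p^p(\mathcal W_{\alpha,\beta}\mu,\mathcal W_{\alpha,\beta}\nu)\,\mathrm d\sigma_{\mathbb S^2}(\Phi(\alpha,\beta))$$ are measurable up to null sets. The vertical sliced Wasserstein distance $\mathrm{VSW}_p$ is a (finite) metric on the set of Borel probability measures $\mu$ on $\mathbb S^2$ that are even with respect to the $\xi_1$–$\xi_2$ plane, i.e. $\int f(\xi_1,\xi_2,\xi_3)\,\mathrm d\mu(\xi)=\int f(\xi_1,\xi_2,-\xi_3)\,\mathrm d\mu(\xi)$ for all $f\in C(\mathbb S^2)$. The semicircular sliced Wasserstein distance $\mathrm{SSW}_p$ is a (finite) metric on the set of all Borel probability measures on $\mathbb S^2$. -/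

import Mathlib

open MeasureTheory Set
open scoped ENNReal Real

noncomputable section

namespace SphereOT

/-- The circle `ℝ / 2πℤ`. Its metric is `d(x, y) = min_k |x - y + 2πk|` and its volume is the
arc length, of total mass `2π`. -/
abbrev Torus : Type := AddCircle (2 * π)

instance factTwoPiPos : Fact (0 < 2 * π) := ⟨Real.two_pi_pos⟩

/-- The interval `[-1, 1]` with the metric `|x - y|`. -/
abbrev Interval : Type := Set.Icc (-1 : ℝ) 1

/-- The unit sphere `S²` in Euclidean `ℝ³`. Coordinates are numbered `0, 1, 2`. -/
abbrev S2 : Type := Metric.sphere (0 : EuclideanSpace ℝ (Fin 3)) 1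

/-- The cosine as a function on the circle. -/
def cosT : Torus → ℝ := Real.cos_periodic.lift

/-- The sine as a function on the circle. -/
def sinT : Torus → ℝ := Real.sin_periodic.lift

/-! ### Wasserstein distances -/

/-- The set `Π(μ, ν)` of (nonnegative) transport plans with marginals `μ` and `ν`. -/
def couplings {X : Type*} [MeasurableSpace X] (μ ν : Measure X) : Set (Measure (X × X)) :=
  {π' | π'.map Prod.fst = μ ∧ π'.map Prod.snd = ν}

/-- The `p`-Wasserstein distance, `W_p(μ, ν)^p = inf_{π ∈ Π(μ, ν)} ∫ d(x, y)^p dπ(x, y)`. -/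
def wasserstein {X : Type*} [MetricSpace X] [MeasurableSpace X] (p : ℝ) (μ ν : Measure X) : ℝ≥0∞ :=
  (⨅ π' ∈ couplings μ ν, ∫⁻ z, edist z.1 z.2 ^ p ∂π') ^ (1 / p)

/-! ### The sphere -/

theorem S2.sq_sum (ξ : S2) : ξ.1 0 ^ 2 + ξ.1 1 ^ 2 + ξ.1 2 ^ 2 = 1 := by
  have h : ‖ξ.1‖ = 1 := norm_eq_of_mem_sphere ξ
  have h2 := EuclideanSpace.real_norm_sq_eq ξ.1
  rw [h, Fin.sum_univ_three] at h2
  linarith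

/-- The point of the sphere with the given coordinates. -/
def S2.mk (x y z : ℝ) (h : x ^ 2 + y ^ 2 + z ^ 2 = 1) : S2 :=
  ⟨!₂[x, y, z], by simp [EuclideanSpace.norm_eq, Fin.sum_univ_three, h]⟩

theorem cosT_sq_add_sinT_sq (φ : Torus) : cosT φ ^ 2 + sinT φ ^ 2 = 1 := by
  induction φ using QuotientAddGroup.induction_on with
  | H x => exact Real.cos_sq_add_sin_sq x

theorem continuous_cosT : Continuous cosT :=
  continuous_coinduced_dom.mpr Real.continuous_cos

theorem continuous_sinT : Continuous sinT :=
  continuous_coinduced_dom.mpr Real.continuous_sin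

/-- Spherical coordinates: azimuth `φ` on the circle, zenith angle `ϑ` (used for `0 ≤ ϑ ≤ π`). -/
def sph (φ : Torus) (ϑ : ℝ) : S2 :=
  S2.mk (cosT φ * Real.sin ϑ) (sinT φ * Real.sin ϑ) (Real.cos ϑ) (by
    linear_combination Real.sin ϑ ^ 2 * cosT_sq_add_sinT_sq φ + Real.cos_sq_add_sin_sq ϑ)

/-- The azimuth angle of a vector; it is `0` on the vertical axis (`Complex.arg 0 = 0`). -/
def azi (x : Fin 3 → ℝ) : Torus := ((Complex.arg ⟨x 0, x 1⟩ : ℝ) : Torus)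

/-- The zenith angle in `[0, π]` of a point of the sphere. -/
def zen (ξ : S2) : ℝ := Real.arccos (ξ.1 2)

/-- The surface measure on the sphere,
`∫ f dσ = ∫_0^π ∫_𝕋 f(sph(φ, ϑ)) sin ϑ dφ dϑ`. -/
def surfaceMeasure : Measure S2 :=
  Measure.map (fun z : Torus × ℝ => sph z.1 z.2)
    ((volume : Measure Torus).prod
      ((volume.restrict (Set.Icc 0 π)).withDensity fun ϑ => ENNReal.ofReal (Real.sin ϑ)))

/-- Reflection at the `ξ₁`-`ξ₂` plane. -/
def reflect (ξ : S2) : S2 :=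
  S2.mk (ξ.1 0) (ξ.1 1) (-ξ.1 2) (by have := S2.sq_sum ξ; linarith)

/-- A measure is even with respect to the `ξ₁`-`ξ₂` plane if `⟨μ, f⟩ = ⟨μ, f ∘ reflect⟩` for all
continuous `f`. -/
def IsEven (μ : ProbabilityMeasure S2) : Prop :=
  ∀ f : C(S2, ℝ), ∫ ξ, f ξ ∂(μ : Measure S2) = ∫ ξ, f (reflect ξ) ∂(μ : Measure S2)

/-! ### The vertical slice transform -/

/-- The slicing operator `S_ψ(ξ) = cos ψ ξ₁ + sin ψ ξ₂`. -/
def slice (ψ : Torus) (ξ : S2) : Interval :=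
  ⟨cosT ψ * ξ.1 0 + sinT ψ * ξ.1 1, by
    have h1 := S2.sq_sum ξ
    have h2 := cosT_sq_add_sinT_sq ψ
    constructor <;>
    nlinarith [sq_nonneg (cosT ψ + ξ.1 0), sq_nonneg (sinT ψ + ξ.1 1), sq_nonneg (ξ.1 2),
      sq_nonneg (cosT ψ - ξ.1 0), sq_nonneg (sinT ψ - ξ.1 1)]⟩

/-- The vertical slice transform `V_ψ μ = (S_ψ)_# μ`. -/
def verticalSlice (ψ : Torus) (μ : Measure S2) : Measure Interval := μ.map (slice ψ)

/-- The vertical sliced Wasserstein distance,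
`VSW_p(μ, ν)^p = ∫_𝕋 W_p(V_ψ μ, V_ψ ν)^p dψ`. -/
def VSW (p : ℝ) (μ ν : Measure S2) : ℝ≥0∞ :=
  (∫⁻ ψ : Torus, wasserstein p (verticalSlice ψ μ) (verticalSlice ψ ν) ^ p) ^ (1 / p)

/-! ### The semicircle transform -/

/-- Rotation by `α` around the third axis. -/
def R3 (α : Torus) : Matrix (Fin 3) (Fin 3) ℝ :=
  !![cosT α, -sinT α, 0; sinT α, cosT α, 0; 0, 0, 1]

/-- Rotation by `β` around the second axis. -/
def R2 (β : ℝ) : Matrix (Fin 3) (Fin 3) ℝ :=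
  !![Real.cos β, 0, Real.sin β; 0, 1, 0; -Real.sin β, 0, Real.cos β]

/-- Euler angles. -/
def eul (α : Torus) (β : ℝ) (γ : Torus) : Matrix (Fin 3) (Fin 3) ℝ := R3 α * R2 β * R3 γ

/-- The azimuth operator `A_{α,β}(ξ) = azi(eul(α, β, 0)ᵀ ξ)`. -/
def azimuth (α : Torus) (β : ℝ) (ξ : S2) : Torus :=
  azi ((eul α β 0).transpose.mulVec ξ.1.ofLp)

/-- The restricted semicircle transform `W_{α,β} μ = (A_{α,β})_# μ`. -/
def semicircle (α : Torus) (β : ℝ) (μ : Measure S2) : Measure Torus := μ.map (azimuth α β)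

/-- The cost `W_p(W_{α,β} μ, W_{α,β} ν)` as a function of the zenith `η = sph(α, β)`. -/
def semicircleDist (p : ℝ) (μ ν : Measure S2) (η : S2) : ℝ≥0∞ :=
  wasserstein p (semicircle (azi η.1.ofLp) (zen η) μ) (semicircle (azi η.1.ofLp) (zen η) ν)

/-- The semicircular sliced Wasserstein distance,
`SSW_p(μ, ν)^p = ∫_{S²} W_p(W_{α,β} μ, W_{α,β} ν)^p dσ(sph(α, β))`. -/
def SSW (p : ℝ) (μ ν : Measure S2) : ℝ≥0∞ :=
  (∫⁻ η, semicircleDist p μ ν η ^ p ∂surfaceMeasure) ^ (1 / p)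

/-! ### Metrics and measurability -/

/-- `d` is a (finite) metric on `X`. -/
structure IsMetric {X : Type*} (d : X → X → ℝ≥0∞) : Prop where
  ne_top : ∀ x y, d x y ≠ ∞
  eq_zero_iff : ∀ x y, d x y = 0 ↔ x = y
  symm : ∀ x y, d x y = d y x
  triangle : ∀ x y z, d x z ≤ d x y + d y z

theorem measurable_coord (i : Fin 3) : Measurable fun ξ : S2 => ξ.1 i := by
  have : Continuous fun ξ : S2 => ξ.1 i := by fun_prop
  exact this.measurable

theorem measurable_sph : Measurable fun z : Torus × ℝ => sph z.1 z.2 := by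
  have hc := continuous_cosT
  have hs := continuous_sinT
  have : Continuous fun z : Torus × ℝ => sph z.1 z.2 := by
    unfold sph S2.mk
    fun_prop
  exact this.measurable

theorem measurable_slice (ψ : Torus) : Measurable (slice ψ) :=
  Measurable.subtype_mk
    (((measurable_coord 0).const_mul _).add ((measurable_coord 1).const_mul _))

theorem measurable_azi : Measurable azi := by
  have h : Measurable fun x : Fin 3 → ℝ => (⟨x 0, x 1⟩ : ℂ) := by
    have : Continuous fun x : Fin 3 → ℝ => Complex.equivRealProdCLM.symm (x 0, x 1) := by fun_prop
    exact this.measurable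
  exact AddCircle.measurable_mk'.comp (Complex.measurable_arg.comp h)

theorem measurable_azimuth (α : Torus) (β : ℝ) : Measurable (azimuth α β) := by
  refine measurable_azi.comp ?_
  have : Continuous fun ξ : S2 => (eul α β 0).transpose.mulVec ξ.1.ofLp := by fun_prop
  exact this.measurable

end SphereOT

end

open SphereOT

/-!
Both distances are `L^p` means, over a family of slices, of Wasserstein distances on a compact
one-dimensional space, so the pseudometric axioms are inherited from the Wasserstein distance
(`wasserstein_triangle`, by gluing transport plans) through Minkowski's inequality
(`isMetric_lintegral_rpow`). What remains is measurability in the slice parameter and the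
injectivity of the two slice transforms.

Measurability: by `continuousAt_wasserstein_map` the distance of two push-forwards is continuous
at each parameter where the maps are continuous almost everywhere. For the vertical slices this is
every `ψ`. The azimuth operator can be discontinuous in the zenith `η` only at the poles and when
the transported point is `±η`; hence the distance is continuous off the countable set
`exceptional μ ν`, which contains the poles and the zeniths for which `±η` carries an atom.
A vanishing mean thus makes the slices agree at every `ψ`, and at every non-exceptional `η`.

Injectivity of the vertical slice transform on even measures: the slices are the one-dimensional
marginals of the projection to the disk, which they determine (`map_disk_eq_of_verticalSlice_eq`),
and an even measure is determined by this projection (`IsEven.eq_of_map_disk_eq`).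

Injectivity of the semicircle transform: let `c` be a vector, `a` a standard Gaussian vector of
`ℝ³` and put `x = ⟨ξ, a⟩`, `y = ⟨ξ, c⟩`. Almost surely `a` is not orthogonal to any exceptional
zenith, so a zenith `η` orthogonal to `a` and `c` is not exceptional. The function
`exp (i s x / y)` on `y > 0` (and `0` elsewhere) is homogeneous of degree zero in the projection of
`ξ` to the plane orthogonal to `η`, hence a function of the azimuth of `ξ`, and has the same
integral under
`μ` and `ν` (`integral_comp_inner_inner_eq`). As `ξ` is a unit vector, averaging over `a` turns it
into `exp (-s² / (2 y²))` on `y > 0`. For `s = √(2k)` these are the moments of `exp (-1 / y²)`,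
which determine the law of `y` on `y > 0` (`setIntegral_comp_inner_eq`). With `±c` one obtains the
law of `⟨ξ, c⟩` for every `c`, that is, the characteristic function of the measure.
-/

namespace SphereOT

open ProbabilityTheory Filter
open scoped Topology NNReal

/-! ### The Wasserstein distance on a compact metric space -/

section Wasserstein

variable {X : Type*} [MetricSpace X] [MeasurableSpace X]

theorem wasserstein_rpow {p : ℝ} (hp : 0 < p) (μ ν : Measure X) :
    wasserstein p μ ν ^ p = ⨅ π' ∈ couplings μ ν, ∫⁻ z, edist z.1 z.2 ^ p ∂π' := by
  rw [wasserstein, ← ENNReal.rpow_mul, one_div_mul_cancel hp.ne', ENNReal.rpow_one]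

theorem wasserstein_le_of_mem_couplings {p : ℝ} (hp : 0 < p) {μ ν : Measure X}
    {π' : Measure (X × X)} (h : π' ∈ couplings μ ν) :
    wasserstein p μ ν ≤ (∫⁻ z, edist z.1 z.2 ^ p ∂π') ^ (1 / p) :=
  ENNReal.rpow_le_rpow (iInf₂_le π' h) (by positivity)

theorem exists_mem_couplings_of_wasserstein_lt {p : ℝ} (hp : 0 < p) {μ ν : Measure X} {r : ℝ≥0∞}
    (h : wasserstein p μ ν < r) :
    ∃ π' ∈ couplings μ ν, (∫⁻ z, edist z.1 z.2 ^ p ∂π') ^ (1 / p) < r := by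
  have h1 : (⨅ π' ∈ couplings μ ν, ∫⁻ z, edist z.1 z.2 ^ p ∂π') < r ^ p := by
    rw [← wasserstein_rpow hp]
    exact ENNReal.rpow_lt_rpow h hp
  simp only [iInf_lt_iff] at h1
  obtain ⟨π', hπ, h2⟩ := h1
  refine ⟨π', hπ, ?_⟩
  rwa [one_div, ENNReal.rpow_inv_lt_iff hp]

variable [CompactSpace X] [BorelSpace X]

theorem wasserstein_symm {p : ℝ} (hp : 0 < p) (μ ν : Measure X) :
    wasserstein p μ ν = wasserstein p ν μ := by
  have key : ∀ μ ν : Measure X, wasserstein p μ ν ≤ wasserstein p ν μ := by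
    intro μ ν
    refine ENNReal.rpow_le_rpow (le_iInf₂ fun π' h => ?_) (by positivity)
    have hmem : π'.map Prod.swap ∈ couplings μ ν := by
      constructor
      · rw [Measure.map_map measurable_fst measurable_swap]; exact h.2
      · rw [Measure.map_map measurable_snd measurable_swap]; exact h.1
    refine (iInf₂_le _ hmem).trans ?_
    · rw [lintegral_map (by fun_prop) measurable_swap]
      simp [edist_comm]
  exact le_antisymm (key μ ν) (key ν μ)

theorem wasserstein_le_diam {p : ℝ} (hp : 0 < p) (μ ν : Measure X) [IsProbabilityMeasure μ]
    [IsProbabilityMeasure ν] : wasserstein p μ ν ≤ Metric.ediam (univ : Set X) := by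
  refine (wasserstein_le_of_mem_couplings hp (π' := μ.prod ν) ⟨?_, ?_⟩).trans ?_
  · simp [Measure.map_fst_prod]
  · simp [Measure.map_snd_prod]
  · rw [one_div, ENNReal.rpow_inv_le_iff hp]
    calc ∫⁻ z, edist z.1 z.2 ^ p ∂μ.prod ν
        ≤ ∫⁻ _, Metric.ediam (univ : Set X) ^ p ∂μ.prod ν := by
          gcongr with z
          exact Metric.edist_le_ediam_of_mem (mem_univ _) (mem_univ _)
      _ = _ := by simp

/-- The coupling `(f, g)_# μ` bounds the distance of two push-forwards of `μ`. -/
theorem wasserstein_map_map_le {p : ℝ} (hp : 0 < p) {Ω : Type*} [MeasurableSpace Ω]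
    (μ : Measure Ω) {f g : Ω → X} (hf : Measurable f) (hg : Measurable g) :
    wasserstein p (μ.map f) (μ.map g) ≤ (∫⁻ ω, edist (f ω) (g ω) ^ p ∂μ) ^ (1 / p) := by
  have hm : Measurable fun z : X × X => edist z.1 z.2 ^ p := by fun_prop
  refine (wasserstein_le_of_mem_couplings hp
    (π' := μ.map fun ω => (f ω, g ω)) ⟨?_, ?_⟩).trans_eq ?_
  · rw [Measure.map_map measurable_fst (hf.prodMk hg)]; rfl
  · rw [Measure.map_map measurable_snd (hf.prodMk hg)]; rfl
  · rw [lintegral_map hm (hf.prodMk hg)]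

theorem wasserstein_self {p : ℝ} (hp : 0 < p) (μ : Measure X) : wasserstein p μ μ = 0 := by
  have h := wasserstein_map_map_le hp μ measurable_id measurable_id (X := X)
  simpa [hp, ENNReal.zero_rpow_of_pos] using h

/-- Gluing of transport plans: two plans that share the middle marginal are the two-dimensional
marginals of one measure, built from their conditional kernels. -/
theorem exists_gluing {μ ν ρ : Measure X} [IsProbabilityMeasure ν]
    {π₁ π₂ : Measure (X × X)} (h₁ : π₁ ∈ couplings μ ν) (h₂ : π₂ ∈ couplings ν ρ) :
    ∃ γ : Measure (X × X × X), γ.map (fun w => (w.2.1, w.1)) = π₁ ∧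
      γ.map (fun w => (w.1, w.2.2)) = π₂ := by
  have : Nonempty X := nonempty_of_isProbabilityMeasure ν
  have hP₂ : IsProbabilityMeasure π₂ := by
    have : IsProbabilityMeasure (π₂.map Prod.fst) := by rw [h₂.1]; infer_instance
    exact Measure.isProbabilityMeasure_of_map Prod.fst
  have hP₁ : IsProbabilityMeasure π₁ := by
    have : IsProbabilityMeasure (π₁.map Prod.snd) := by rw [h₁.2]; infer_instance
    exact Measure.isProbabilityMeasure_of_map Prod.snd
  have hP₁' : IsProbabilityMeasure (π₁.map Prod.swap) :=
    Measure.isProbabilityMeasure_map measurable_swap.aemeasurable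
  have hd₁ : ν ⊗ₘ (π₁.map Prod.swap).condKernel = π₁.map Prod.swap := by
    have := (π₁.map Prod.swap).disintegrate (π₁.map Prod.swap).condKernel
    rwa [Measure.fst, Measure.map_map measurable_fst measurable_swap,
      show Prod.fst ∘ Prod.swap = (Prod.snd : X × X → X) from rfl, h₁.2] at this
  have hd₂ : ν ⊗ₘ π₂.condKernel = π₂ := by
    have := π₂.disintegrate π₂.condKernel
    rwa [Measure.fst, h₂.1] at this
  set κ₁ := (π₁.map Prod.swap).condKernel
  set κ₂ := π₂.condKernel
  refine ⟨ν ⊗ₘ (κ₁ ×ₖ κ₂), ?_, ?_⟩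
  · have e : (ν ⊗ₘ (κ₁ ×ₖ κ₂)).map (Prod.map id Prod.fst) = π₁.map Prod.swap := by
      rw [← Measure.compProd_map measurable_fst, ← Kernel.fst_eq, Kernel.fst_prod, hd₁]
    have : π₁ = (π₁.map Prod.swap).map Prod.swap := by
      rw [Measure.map_map measurable_swap measurable_swap]; simp
    rw [this, ← e, Measure.map_map measurable_swap (by fun_prop)]
    rfl
  · have e : (ν ⊗ₘ (κ₁ ×ₖ κ₂)).map (Prod.map id Prod.snd) = π₂ := by
      rw [← Measure.compProd_map measurable_snd, ← Kernel.snd_eq, Kernel.snd_prod, hd₂]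
    exact e

theorem wasserstein_triangle {p : ℝ} (hp : 1 ≤ p) (μ ν ρ : Measure X) [IsProbabilityMeasure ν] :
    wasserstein p μ ρ ≤ wasserstein p μ ν + wasserstein p ν ρ := by
  have hp0 : 0 < p := by linarith
  refine ENNReal.le_of_forall_pos_le_add fun ε hε hfin => ?_
  obtain ⟨hf₁, hf₂⟩ := ENNReal.add_lt_top.1 hfin
  have hε2 : (ε / 2 : ℝ≥0∞) ≠ 0 := by simp [hε.ne']
  obtain ⟨π₁, h₁, hc₁⟩ := exists_mem_couplings_of_wasserstein_lt hp0
    (ENNReal.lt_add_right hf₁.ne hε2)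
  obtain ⟨π₂, h₂, hc₂⟩ := exists_mem_couplings_of_wasserstein_lt hp0
    (ENNReal.lt_add_right hf₂.ne hε2)
  obtain ⟨γ, hγ₁, hγ₂⟩ := exists_gluing h₁ h₂
  have hm : Measurable fun z : X × X => edist z.1 z.2 ^ p := by fun_prop
  have hm1 : Measurable fun w : X × X × X => (w.2.1, w.1) := by fun_prop
  have hm2 : Measurable fun w : X × X × X => (w.1, w.2.2) := by fun_prop
  calc wasserstein p μ ρ
      ≤ (∫⁻ z, edist z.1 z.2 ^ p ∂γ.map Prod.snd) ^ (1 / p) := by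
        refine wasserstein_le_of_mem_couplings hp0 ⟨?_, ?_⟩
        · rw [Measure.map_map measurable_fst measurable_snd, ← h₁.1, ← hγ₁,
            Measure.map_map measurable_fst hm1]
          rfl
        · rw [Measure.map_map measurable_snd measurable_snd, ← h₂.2, ← hγ₂,
            Measure.map_map measurable_snd hm2]
          rfl
    _ ≤ (∫⁻ w, ((fun w : X × X × X => edist w.2.1 w.1) +
          fun w : X × X × X => edist w.1 w.2.2) w ^ p ∂γ)
          ^ (1 / p) := by
        rw [lintegral_map hm measurable_snd]
        gcongr with w
        exact edist_triangle _ _ _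
    _ ≤ (∫⁻ w, edist w.2.1 w.1 ^ p ∂γ) ^ (1 / p) + (∫⁻ w, edist w.1 w.2.2 ^ p ∂γ) ^ (1 / p) :=
        ENNReal.lintegral_Lp_add_le (by fun_prop) (by fun_prop) hp
    _ = (∫⁻ z, edist z.1 z.2 ^ p ∂π₁) ^ (1 / p) + (∫⁻ z, edist z.1 z.2 ^ p ∂π₂) ^ (1 / p) := by
        rw [← hγ₁, ← hγ₂, lintegral_map hm hm1, lintegral_map hm hm2]
    _ ≤ (wasserstein p μ ν + ε / 2) + (wasserstein p ν ρ + ε / 2) := by gcongr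
    _ = wasserstein p μ ν + wasserstein p ν ρ + ε := by
        rw [add_add_add_comm, ENNReal.add_halves]

/-- By Markov's inequality, `μ F ≤ ν F` for closed `F` as soon as plans of arbitrarily small cost
exist. -/
theorem measure_le_of_wasserstein_eq_zero {p : ℝ} (hp : 0 < p) {μ ν : Measure X}
    [IsProbabilityMeasure ν] (h : wasserstein p μ ν = 0) {F : Set X} (hF : IsClosed F) :
    μ F ≤ ν F := by
  have hthick : ∀ ε : ℝ, 0 < ε → μ F ≤ ν (Metric.thickening ε F) := by
    intro ε hε
    refine ENNReal.le_of_forall_pos_le_add fun δ hδ _ => ?_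
    have hε' : ENNReal.ofReal ε ^ p ≠ 0 := by simp [hε]
    have hε'' : ENNReal.ofReal ε ^ p ≠ ∞ := ENNReal.rpow_ne_top_of_nonneg hp.le (by simp)
    have h0 : (⨅ π' ∈ couplings μ ν, ∫⁻ z, edist z.1 z.2 ^ p ∂π') < δ * ENNReal.ofReal ε ^ p := by
      rw [← wasserstein_rpow hp, h, ENNReal.zero_rpow_of_pos hp]
      exact ENNReal.mul_pos (by simpa using hδ.ne') hε'
    simp only [iInf_lt_iff] at h0
    obtain ⟨π', hπ, hc⟩ := h0
    have hm : Measurable fun z : X × X => edist z.1 z.2 ^ p := by fun_prop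
    have hT : MeasurableSet (Metric.thickening ε F) := Metric.isOpen_thickening.measurableSet
    have hmark : π' {z | ENNReal.ofReal ε ^ p ≤ edist z.1 z.2 ^ p} ≤ δ := by
      refine (meas_ge_le_lintegral_div hm.aemeasurable hε' hε'').trans ?_
      exact (ENNReal.div_le_iff hε' hε'').2 hc.le
    calc μ F = π' (Prod.fst ⁻¹' F) := by
          rw [← hπ.1, Measure.map_apply measurable_fst hF.measurableSet]
      _ ≤ π' (Prod.snd ⁻¹' Metric.thickening ε F ∪
            {z | ENNReal.ofReal ε ^ p ≤ edist z.1 z.2 ^ p}) := by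
          refine measure_mono fun z hz => ?_
          by_cases hd : dist z.2 z.1 < ε
          · exact Or.inl (Metric.mem_thickening_iff.2 ⟨z.1, hz, hd⟩)
          · refine Or.inr (ENNReal.rpow_le_rpow ?_ hp.le)
            rw [edist_comm, edist_dist]
            exact ENNReal.ofReal_le_ofReal (not_lt.1 hd)
      _ ≤ π' (Prod.snd ⁻¹' Metric.thickening ε F) + δ :=
          (measure_union_le _ _).trans (by gcongr)
      _ = ν (Metric.thickening ε F) + δ := by
          rw [← hπ.2, Measure.map_apply measurable_snd hT]
  exact ge_of_tendsto (tendsto_measure_thickening_of_isClosed ⟨1, one_pos, by finiteness⟩ hF)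
    (eventually_mem_nhdsWithin.mono fun ε hε => hthick ε hε)

theorem eq_of_wasserstein_eq_zero {p : ℝ} (hp : 0 < p) {μ ν : Measure X}
    [IsProbabilityMeasure μ] [IsProbabilityMeasure ν] (h : wasserstein p μ ν = 0) : μ = ν := by
  refine ext_of_generate_finite _ (BorelSpace.measurable_eq.trans borel_eq_generateFrom_isClosed)
    isPiSystem_isClosed (fun F hF => ?_) (by simp)
  exact le_antisymm (measure_le_of_wasserstein_eq_zero hp h hF)
    (measure_le_of_wasserstein_eq_zero hp (wasserstein_symm hp μ ν ▸ h) hF)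

/-- The distance of two push-forwards is continuous at a parameter value at which the maps are
continuous almost everywhere. -/
theorem continuousAt_wasserstein_map {p : ℝ} (hp : 1 ≤ p) {Ω E : Type*} [MeasurableSpace Ω]
    [TopologicalSpace E] [FirstCountableTopology E] (μ ν : Measure Ω) [IsProbabilityMeasure μ]
    [IsProbabilityMeasure ν] {f : E → Ω → X} (hf : ∀ e, Measurable (f e)) {e₀ : E}
    (hμ : ∀ᵐ ω ∂μ, ContinuousAt (fun e => f e ω) e₀)
    (hν : ∀ᵐ ω ∂ν, ContinuousAt (fun e => f e ω) e₀) :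
    ContinuousAt (fun e => wasserstein p (μ.map (f e)) (ν.map (f e))) e₀ := by
  have hp0 : 0 < p := by linarith
  have hprob : ∀ (μ : Measure Ω) [IsProbabilityMeasure μ] (e), IsProbabilityMeasure (μ.map (f e)) :=
    fun μ _ e => Measure.isProbabilityMeasure_map (hf e).aemeasurable
  have key : ∀ (μ : Measure Ω) [IsProbabilityMeasure μ],
      (∀ᵐ ω ∂μ, ContinuousAt (fun e => f e ω) e₀) →
      Tendsto (fun e => wasserstein p (μ.map (f e)) (μ.map (f e₀))) (𝓝 e₀) (𝓝 0) := by
    intro μ _ h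
    have hlim : Tendsto (fun e => ∫⁻ ω, edist (f e ω) (f e₀ ω) ^ p ∂μ) (𝓝 e₀) (𝓝 0) := by
      have := tendsto_lintegral_filter_of_dominated_convergence (μ := μ) (l := 𝓝 e₀)
        (F := fun e ω => edist (f e ω) (f e₀ ω) ^ p) (f := fun _ => 0)
        (fun _ => Metric.ediam (univ : Set X) ^ p)
        (Eventually.of_forall fun e => by
          have := (hf e).edist (hf e₀)
          exact this.pow_const p)
        (Eventually.of_forall fun e => ae_of_all _ fun ω => ENNReal.rpow_le_rpow
          (Metric.edist_le_ediam_of_mem (mem_univ _) (mem_univ _)) hp0.le)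
        (by
          simp only [lintegral_const, measure_univ, mul_one]
          exact ENNReal.rpow_ne_top_of_nonneg hp0.le isCompact_univ.isBounded.ediam_ne_top)
        (h.mono fun ω hω => by
          have h1 : Tendsto (fun e => edist (f e ω) (f e₀ ω)) (𝓝 e₀) (𝓝 0) :=
            tendsto_iff_edist_tendsto_0.1 hω
          simpa [hp0] using h1.ennrpow_const p)
      simpa using this
    refine tendsto_of_tendsto_of_tendsto_of_le_of_le tendsto_const_nhds
      (h := fun e => (∫⁻ ω, edist (f e ω) (f e₀ ω) ^ p ∂μ) ^ (1 / p)) ?_ (fun _ => zero_le)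
      (fun e => wasserstein_map_map_le hp0 μ (hf e) (hf e₀))
    simpa [hp0] using hlim.ennrpow_const (1 / p)
  have hδ : Tendsto (fun e => wasserstein p (μ.map (f e)) (μ.map (f e₀)) +
      wasserstein p (ν.map (f e)) (ν.map (f e₀))) (𝓝 e₀) (𝓝 0) := by
    simpa using (key μ hμ).add (key ν hν)
  set W := wasserstein p (μ.map (f e₀)) (ν.map (f e₀)) with hW
  have hWfin : W ≠ ∞ := ne_top_of_le_ne_top isCompact_univ.isBounded.ediam_ne_top
    (wasserstein_le_diam hp0 _ _)
  have hup := tendsto_const_nhds (x := W) |>.add hδ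
  have hlow := ENNReal.Tendsto.sub (tendsto_const_nhds (x := W)) hδ (Or.inl hWfin)
  rw [add_zero] at hup
  rw [tsub_zero] at hlow
  refine tendsto_of_tendsto_of_tendsto_of_le_of_le hlow hup (fun e => ?_) (fun e => ?_)
  · refine tsub_le_iff_right.2 ?_
    calc W ≤ wasserstein p (μ.map (f e₀)) (μ.map (f e)) +
          (wasserstein p (μ.map (f e)) (ν.map (f e)) +
            wasserstein p (ν.map (f e)) (ν.map (f e₀))) :=
          (wasserstein_triangle hp _ (μ.map (f e)) _).trans
            (add_le_add le_rfl (wasserstein_triangle hp _ (ν.map (f e)) _))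
      _ = _ := by
          rw [wasserstein_symm hp0 (μ.map (f e₀)) (μ.map (f e))]
          ring
  · calc wasserstein p (μ.map (f e)) (ν.map (f e))
        ≤ wasserstein p (μ.map (f e)) (μ.map (f e₀)) + (W +
            wasserstein p (ν.map (f e₀)) (ν.map (f e))) :=
          (wasserstein_triangle hp _ (μ.map (f e₀)) _).trans
            (add_le_add le_rfl (wasserstein_triangle hp _ (ν.map (f e₀)) _))
      _ = _ := by
          rw [wasserstein_symm hp0 (ν.map (f e₀)) (ν.map (f e))]
          ring

end Wasserstein

/-! ### Metrics by integration over slices -/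

/-- The `L^p` mean of a family of uniformly bounded pseudometrics that jointly separate points is a
metric. -/
theorem isMetric_lintegral_rpow {p : ℝ} (hp : 1 ≤ p) {E M : Type*} [MeasurableSpace E]
    {σ : Measure E} [IsFiniteMeasure σ] {w : E → M → M → ℝ≥0∞} {C : ℝ≥0∞} (hC : C ≠ ∞)
    (hbound : ∀ e m n, w e m n ≤ C) (hself : ∀ e m, w e m m = 0)
    (hsymm : ∀ e m n, w e m n = w e n m) (htri : ∀ e m n o, w e m o ≤ w e m n + w e n o)
    (hmeas : ∀ m n, AEMeasurable (fun e => w e m n) σ)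
    (hsep : ∀ m n, (∀ᵐ e ∂σ, w e m n = 0) → m = n) :
    IsMetric fun m n => (∫⁻ e, w e m n ^ p ∂σ) ^ (1 / p) where
  ne_top m n := by
    refine ENNReal.rpow_ne_top_of_nonneg (by positivity) (ne_top_of_le_ne_top ?_
      (lintegral_mono fun e => ENNReal.rpow_le_rpow (hbound e m n) (by linarith)))
    rw [lintegral_const]
    exact ENNReal.mul_ne_top (ENNReal.rpow_ne_top_of_nonneg (by linarith) hC) (by finiteness)
  eq_zero_iff m n := by
    have hp0 : 0 < p := by linarith
    constructor
    · intro h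
      rw [ENNReal.rpow_eq_zero_iff_of_pos (by positivity),
        lintegral_eq_zero_iff' ((hmeas m n).pow_const p)] at h
      refine hsep m n (h.mono fun e he => ?_)
      exact (ENNReal.rpow_eq_zero_iff_of_pos hp0).1 he
    · rintro rfl
      simp [hself, hp0]
  symm m n := by simp only [hsymm _ m n]
  triangle m n o := by
    calc (∫⁻ e, w e m o ^ p ∂σ) ^ (1 / p)
        ≤ (∫⁻ e, ((fun e => w e m n) + fun e => w e n o) e ^ p ∂σ) ^ (1 / p) := by
          gcongr with e
          exact htri e m n o
      _ ≤ _ := ENNReal.lintegral_Lp_add_le (hmeas m n) (hmeas n o) hp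

/-! ### Measures on the sphere and their characteristic functions -/

theorem eq_of_forall_integral_exp_inner_eq {μ ν : Measure S2} [IsFiniteMeasure μ]
    [IsFiniteMeasure ν]
    (h : ∀ t : EuclideanSpace ℝ (Fin 3), ∫ ξ : S2, Complex.exp (inner ℝ ξ.1 t * Complex.I) ∂μ =
      ∫ ξ : S2, Complex.exp (inner ℝ ξ.1 t * Complex.I) ∂ν) : μ = ν := by
  have hemb : MeasurableEmbedding fun ξ : S2 => ξ.1 :=
    MeasurableEmbedding.subtype_coe Metric.isClosed_sphere.measurableSet
  have hmap : μ.map (fun ξ : S2 => ξ.1) = ν.map fun ξ : S2 => ξ.1 := by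
    refine Measure.ext_of_charFun (funext fun t => ?_)
    rw [charFun_apply, charFun_apply, hemb.integral_map, hemb.integral_map]
    exact h t
  rw [← hemb.comap_map μ, hmap, hemb.comap_map]

/-! ### The vertical slice transform -/

theorem continuous_slice_left (ξ : S2) : Continuous fun ψ => slice ψ ξ := by
  have hc := continuous_cosT
  have hs := continuous_sinT
  unfold slice
  fun_prop

theorem continuous_wasserstein_verticalSlice {p : ℝ} (hp : 1 ≤ p) (μ ν : Measure S2)
    [IsProbabilityMeasure μ] [IsProbabilityMeasure ν] :
    Continuous fun ψ => wasserstein p (verticalSlice ψ μ) (verticalSlice ψ ν) :=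
  continuous_iff_continuousAt.2 fun _ => continuousAt_wasserstein_map hp μ ν measurable_slice
    (ae_of_all _ fun ξ => (continuous_slice_left ξ).continuousAt)
    (ae_of_all _ fun ξ => (continuous_slice_left ξ).continuousAt)

instance isProbabilityMeasure_verticalSlice (ψ : Torus) (μ : Measure S2) [IsProbabilityMeasure μ] :
    IsProbabilityMeasure (verticalSlice ψ μ) :=
  Measure.isProbabilityMeasure_map (measurable_slice ψ).aemeasurable

/-- The orthogonal projection of the sphere to the `ξ₁`-`ξ₂` plane. -/
def disk (ξ : S2) : EuclideanSpace ℝ (Fin 2) := !₂[ξ.1 0, ξ.1 1]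

theorem continuous_disk : Continuous disk := by
  unfold disk
  fun_prop

/-- The vertical slices are the one-dimensional marginals of the projection to the disk, which is
therefore determined by them (Cramér–Wold). -/
theorem map_disk_eq_of_verticalSlice_eq {μ ν : Measure S2} [IsFiniteMeasure μ] [IsFiniteMeasure ν]
    (h : ∀ ψ, verticalSlice ψ μ = verticalSlice ψ ν) : μ.map disk = ν.map disk := by
  refine Measure.ext_of_charFun (funext fun t => ?_)
  set z : ℂ := ⟨t 0, t 1⟩ with hz
  have hcos : ‖z‖ * cosT (z.arg : ℝ) = t 0 := Complex.norm_mul_cos_arg z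
  have hsin : ‖z‖ * sinT (z.arg : ℝ) = t 1 := Complex.norm_mul_sin_arg z
  have hinner : ∀ ξ : S2, inner ℝ (disk ξ) t = ‖z‖ * (slice (z.arg : ℝ) ξ : ℝ) := by
    intro ξ
    simp only [disk, slice, PiLp.inner_apply, Fin.sum_univ_two]
    simp only [← hcos, ← hsin, RCLike.inner_apply, conj_trivial,
      Matrix.cons_val_zero, Matrix.cons_val_one]
    ring
  have key : ∀ μ : Measure S2, charFun (μ.map disk) t =
      ∫ x : Interval, Complex.exp ((‖z‖ * (x : ℝ) : ℝ) * Complex.I)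
        ∂verticalSlice (z.arg : ℝ) μ := by
    intro μ
    rw [charFun_apply, verticalSlice, integral_map continuous_disk.aemeasurable (by fun_prop),
      integral_map (measurable_slice _).aemeasurable (by fun_prop)]
    simp only [hinner]
  rw [key, key, h]

theorem continuous_reflect : Continuous reflect := by
  unfold reflect S2.mk
  fun_prop

theorem IsEven.map_reflect {μ : ProbabilityMeasure S2} (h : IsEven μ) :
    (μ : Measure S2).map reflect = μ := by
  have := Measure.isProbabilityMeasure_map (μ := (μ : Measure S2))
    continuous_reflect.measurable.aemeasurable
  refine ext_of_forall_integral_eq_of_IsFiniteMeasure fun f => ?_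
  rw [integral_map continuous_reflect.aemeasurable f.continuous.aestronglyMeasurable]
  exact (h f.toContinuousMap).symm

/-- For an even measure, averaging over the reflection replaces `exp (i t₃ ξ₃)` by
`cos (t₃ √(1 - ξ₁² - ξ₂²))` in the characteristic function. -/
theorem IsEven.integral_exp_inner {μ : ProbabilityMeasure S2} (h : IsEven μ)
    (t : EuclideanSpace ℝ (Fin 3)) :
    ∫ ξ : S2, Complex.exp (inner ℝ ξ.1 t * Complex.I) ∂(μ : Measure S2) =
      ∫ v, Complex.exp ((v 0 * t 0 + v 1 * t 1 : ℝ) * Complex.I) *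
        (Real.cos (t 2 * √(1 - v 0 ^ 2 - v 1 ^ 2)) : ℝ) ∂((μ : Measure S2).map disk) := by
  set F : S2 → ℂ := fun ξ => Complex.exp (inner ℝ ξ.1 t * Complex.I) with hF
  have hFc : Continuous F := by fun_prop
  have hFi : ∀ g : S2 → S2, Continuous g → Integrable (fun ξ => F (g ξ)) (μ : Measure S2) := by
    intro g hg
    refine (integrable_const (1 : ℝ)).mono' (by fun_prop) (ae_of_all _ fun ξ => ?_)
    rw [hF, Complex.norm_exp_ofReal_mul_I]
  have hrefl : ∫ ξ, F (reflect ξ) ∂(μ : Measure S2) = ∫ ξ, F ξ ∂(μ : Measure S2) := by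
    conv_rhs => rw [← h.map_reflect]
    rw [integral_map continuous_reflect.aemeasurable (by fun_prop)]
  rw [integral_map continuous_disk.aemeasurable (by fun_prop)]
  have hsum : ∫ ξ, F ξ ∂(μ : Measure S2) = ∫ ξ, (F ξ + F (reflect ξ)) / 2 ∂(μ : Measure S2) := by
    rw [integral_div, integral_add (show Integrable F _ from hFi id continuous_id)
      (hFi _ continuous_reflect), hrefl]
    ring
  rw [hsum]
  refine integral_congr_ae (ae_of_all _ fun ξ => ?_)
  have hz : 1 - ξ.1 0 ^ 2 - ξ.1 1 ^ 2 = ξ.1 2 ^ 2 := by linarith [S2.sq_sum ξ]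
  have hcos : Real.cos (t 2 * √(1 - ξ.1 0 ^ 2 - ξ.1 1 ^ 2)) = Real.cos (t 2 * ξ.1 2) := by
    rw [hz, Real.sqrt_sq_eq_abs, ← Real.cos_abs (t 2 * |_|), ← Real.cos_abs (t 2 * _), abs_mul,
      abs_abs, abs_mul]
  have hd0 : disk ξ 0 = ξ.1 0 := rfl
  have hd1 : disk ξ 1 = ξ.1 1 := rfl
  have hi : ∀ ζ : S2, inner ℝ ζ.1 t = (ζ.1 0 * t 0 + ζ.1 1 * t 1) + t 2 * ζ.1 2 := by
    intro ζ
    simp only [PiLp.inner_apply, Fin.sum_univ_three, RCLike.inner_apply, conj_trivial]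
    ring
  have hr0 : (reflect ξ).1 0 = ξ.1 0 := rfl
  have hr1 : (reflect ξ).1 1 = ξ.1 1 := rfl
  have hr2 : (reflect ξ).1 2 = -ξ.1 2 := rfl
  simp only [hF, hd0, hd1, hcos, hi, hr0, hr1, hr2]
  push_cast
  rw [Complex.cos, mul_div_assoc', mul_add, ← Complex.exp_add, ← Complex.exp_add]
  ring_nf

theorem IsEven.eq_of_map_disk_eq {μ ν : ProbabilityMeasure S2} (hμ : IsEven μ) (hν : IsEven ν)
    (h : (μ : Measure S2).map disk = (ν : Measure S2).map disk) : μ = ν := by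
  refine Subtype.ext (eq_of_forall_integral_exp_inner_eq (μ := (μ : Measure S2))
    (ν := (ν : Measure S2)) fun t => ?_)
  exact (hμ.integral_exp_inner t).trans (h ▸ (hν.integral_exp_inner t).symm)

theorem isMetric_VSW {p : ℝ} (hp : 1 ≤ p) :
    IsMetric fun μ ν : {μ : ProbabilityMeasure S2 // IsEven μ} =>
      VSW p (μ.1 : Measure S2) (ν.1 : Measure S2) := by
  have hp0 : 0 < p := by linarith
  refine isMetric_lintegral_rpow hp (w := fun ψ (μ ν : {μ : ProbabilityMeasure S2 // IsEven μ}) =>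
      wasserstein p (verticalSlice ψ (μ.1 : Measure S2)) (verticalSlice ψ (ν.1 : Measure S2)))
    (isCompact_univ (X := Interval)).isBounded.ediam_ne_top
    (fun ψ μ ν => wasserstein_le_diam hp0 _ _) (fun ψ μ => wasserstein_self hp0 _)
    (fun ψ μ ν => wasserstein_symm hp0 _ _) (fun ψ μ ν ρ => wasserstein_triangle hp _ _ _)
    (fun μ ν => (continuous_wasserstein_verticalSlice hp _ _).aemeasurable) fun μ ν h => ?_
  have hall := ((continuous_wasserstein_verticalSlice hp _ _).ae_eq_iff_eq volume
    (continuous_const (y := (0 : ℝ≥0∞)))).1 h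
  exact Subtype.ext (μ.2.eq_of_map_disk_eq ν.2
    (map_disk_eq_of_verticalSlice_eq fun ψ => eq_of_wasserstein_eq_zero hp0 (congrFun hall ψ)))

/-! ### The surface measure -/

theorem lintegral_sin_ne_top :
    ∫⁻ ϑ in Icc 0 π, ENNReal.ofReal (Real.sin ϑ) ≠ ∞ := by
  refine ne_top_of_le_ne_top ?_ (lintegral_mono (g := fun _ => 1) fun ϑ => ?_)
  · simp
  · exact ENNReal.ofReal_le_one.2 (Real.sin_le_one ϑ)

instance isFiniteMeasure_surfaceMeasure : IsFiniteMeasure surfaceMeasure := by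
  have := isFiniteMeasure_withDensity lintegral_sin_ne_top
  unfold surfaceMeasure
  infer_instance

instance nullSingletonClass_surfaceMeasure : NullSingletonClass surfaceMeasure where
  measure_singleton η := by
    have := isFiniteMeasure_withDensity lintegral_sin_ne_top
    rw [surfaceMeasure, Measure.map_apply measurable_sph (measurableSet_singleton η)]
    refine measure_mono_null (t := univ ×ˢ {ϑ | Real.cos ϑ = η.1 2}) ?_ ?_
    · rintro ⟨φ, ϑ⟩ (h : sph φ ϑ = η)
      refine ⟨mem_univ _, ?_⟩
      rw [mem_ofPred_eq, ← h]
      rfl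
    · rw [Measure.prod_prod]
      refine mul_eq_zero_of_right _ (withDensity_absolutelyContinuous _ _ ?_)
      rw [Measure.restrict_apply (measurableSet_eq_fun Real.measurable_cos measurable_const)]
      refine Set.Subsingleton.measure_zero (fun x hx y hy => ?_) _
      exact Real.injOn_cos hx.2 hy.2 (hx.1.trans hy.1.symm)

theorem sq_add_sq_ne_zero_iff (η : S2) : η.1 0 ^ 2 + η.1 1 ^ 2 ≠ 0 ↔ ¬(η.1 0 = 0 ∧ η.1 1 = 0) := by
  rw [ne_eq, add_eq_zero_iff_of_nonneg (sq_nonneg _) (sq_nonneg _)]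
  simp

theorem sin_zen (η : S2) : Real.sin (zen η) = √(η.1 0 ^ 2 + η.1 1 ^ 2) := by
  rw [zen, Real.sin_arccos]
  congr 1
  linarith [S2.sq_sum η]

theorem cos_zen (η : S2) : Real.cos (zen η) = η.1 2 := by
  have := S2.sq_sum η
  exact Real.cos_arccos (by nlinarith [sq_nonneg (η.1 0), sq_nonneg (η.1 1)])
    (by nlinarith [sq_nonneg (η.1 0), sq_nonneg (η.1 1)])

theorem norm_mk_coord (η : S2) : ‖(⟨η.1 0, η.1 1⟩ : ℂ)‖ = √(η.1 0 ^ 2 + η.1 1 ^ 2) := by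
  rw [Complex.norm_def, Complex.normSq_apply]
  ring_nf

theorem cosT_azi_mul_sin_zen (η : S2) : cosT (azi η.1.ofLp) * Real.sin (zen η) = η.1 0 := by
  rw [sin_zen, ← norm_mk_coord, mul_comm]
  exact Complex.norm_mul_cos_arg _

theorem sinT_azi_mul_sin_zen (η : S2) : sinT (azi η.1.ofLp) * Real.sin (zen η) = η.1 1 := by
  rw [sin_zen, ← norm_mk_coord, mul_comm]
  exact Complex.norm_mul_sin_arg _

theorem sph_azi_zen (η : S2) : sph (azi η.1.ofLp) (zen η) = η := by
  refine Subtype.ext (PiLp.ext fun i => ?_)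
  fin_cases i
  · exact cosT_azi_mul_sin_zen η
  · exact sinT_azi_mul_sin_zen η
  · exact cos_zen η

theorem continuous_sph : Continuous fun z : Torus × ℝ => sph z.1 z.2 := by
  have hc := continuous_cosT
  have hs := continuous_sinT
  unfold sph S2.mk
  fun_prop

theorem surfaceMeasure_ne_zero_of_mem_nhds {η : S2} (hη : ¬(η.1 0 = 0 ∧ η.1 1 = 0)) {U : Set S2}
    (hU : U ∈ 𝓝 η) : surfaceMeasure U ≠ 0 := by
  have := isFiniteMeasure_withDensity lintegral_sin_ne_top
  have hsin : 0 < Real.sin (zen η) := by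
    rw [sin_zen]
    exact Real.sqrt_pos.2 (lt_of_le_of_ne (by positivity) ((sq_add_sq_ne_zero_iff η).2 hη).symm)
  have hnhds : (fun z : Torus × ℝ => sph z.1 z.2) ⁻¹' U ∈ 𝓝 (azi η.1.ofLp, zen η) :=
    continuous_sph.continuousAt.preimage_mem_nhds (by simpa only [sph_azi_zen] using hU)
  rw [nhds_prod_eq, Filter.mem_prod_iff] at hnhds
  obtain ⟨A, hA, B, hB, hAB⟩ := hnhds
  intro h0
  have h1 := le_antisymm ((Measure.le_map_apply measurable_sph.aemeasurable U).trans h0.le)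
    zero_le
  have h2 := measure_mono_null hAB h1
  rw [Measure.prod_prod, mul_eq_zero] at h2
  rcases h2 with h2 | h2
  · exact (Measure.measure_pos_of_mem_nhds volume hA).ne' h2
  · rw [withDensity_apply_eq_zero (by fun_prop)] at h2
    have hpos : Ioo 0 π ∈ 𝓝 (zen η) := by
      have h3 : zen η ∈ Icc 0 π := ⟨Real.arccos_nonneg _, Real.arccos_le_pi _⟩
      refine Ioo_mem_nhds (lt_of_le_of_ne h3.1 ?_) (lt_of_le_of_ne h3.2 ?_)
      · intro h; rw [← h] at hsin; simp at hsin
      · intro h; rw [h] at hsin; simp at hsin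
    refine (Measure.measure_pos_of_mem_nhds volume (inter_mem hB hpos)).ne' ?_
    rw [← nonpos_iff_eq_zero, ← h2]
    calc volume (B ∩ Ioo 0 π) = volume.restrict (Icc 0 π) (B ∩ Ioo 0 π) :=
          (Measure.restrict_eq_self _ fun x hx => Ioo_subset_Icc_self hx.2).symm
      _ ≤ _ := measure_mono fun x hx =>
          show _ ∧ _ from ⟨by simpa using Real.sin_pos_of_mem_Ioo hx.2, hx.1⟩

/-! ### The frame at a zenith -/

theorem R3_mul_transpose (α : Torus) : R3 α * (R3 α).transpose = 1 := by
  have h := cosT_sq_add_sinT_sq α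
  ext i j
  fin_cases i <;> fin_cases j <;> simp [R3, Matrix.mul_apply, Fin.sum_univ_three] <;> linarith

theorem R2_mul_transpose (β : ℝ) : R2 β * (R2 β).transpose = 1 := by
  have h := Real.cos_sq_add_sin_sq β
  ext i j
  fin_cases i <;> fin_cases j <;> simp [R2, Matrix.mul_apply, Fin.sum_univ_three] <;> linarith

theorem eul_mul_transpose (α : Torus) (β : ℝ) (γ : Torus) :
    eul α β γ * (eul α β γ).transpose = 1 := by
  rw [eul, Matrix.transpose_mul, Matrix.transpose_mul]
  calc R3 α * R2 β * R3 γ * ((R3 γ).transpose * ((R2 β).transpose * (R3 α).transpose))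
      = R3 α * (R2 β * (R3 γ * (R3 γ).transpose) * (R2 β).transpose) * (R3 α).transpose := by
        simp only [Matrix.mul_assoc]
    _ = 1 := by
        rw [R3_mul_transpose, Matrix.mul_one, R2_mul_transpose, Matrix.mul_one, R3_mul_transpose]

/-- The coordinates of `x` in the orthonormal frame `eul(azi η, zen η, 0)`, whose third vector
is `η`. -/
noncomputable def frame (η : S2) (x : EuclideanSpace ℝ (Fin 3)) : Fin 3 → ℝ :=
  (eul (azi η.1.ofLp) (zen η) 0).transpose.mulVec x.ofLp

theorem frame_dotProduct (η : S2) (x y : EuclideanSpace ℝ (Fin 3)) :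
    frame η x 0 * frame η y 0 + frame η x 1 * frame η y 1 + frame η x 2 * frame η y 2 =
      inner ℝ x y := by
  have h : frame η x ⬝ᵥ frame η y = x.ofLp ⬝ᵥ y.ofLp := by
    rw [frame, frame, Matrix.dotProduct_mulVec, Matrix.vecMul_transpose, Matrix.mulVec_mulVec,
      eul_mul_transpose, Matrix.one_mulVec]
  simp only [dotProduct, Fin.sum_univ_three] at h
  rw [h, PiLp.inner_apply, Fin.sum_univ_three]
  simp only [RCLike.inner_apply, conj_trivial]
  ring

theorem cosT_zero : cosT 0 = 1 := Real.cos_zero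

theorem sinT_zero : sinT 0 = 0 := Real.sin_zero

theorem frame_two (η : S2) (x : EuclideanSpace ℝ (Fin 3)) : frame η x 2 = inner ℝ η.1 x := by
  have h : frame η x 2 = cosT (azi η.1.ofLp) * Real.sin (zen η) * x 0 +
      sinT (azi η.1.ofLp) * Real.sin (zen η) * x 1 + Real.cos (zen η) * x 2 := by
    simp [frame, eul, R2, R3, Matrix.mulVec, dotProduct, Fin.sum_univ_three,
      cosT_zero, sinT_zero]
  rw [h, cosT_azi_mul_sin_zen, sinT_azi_mul_sin_zen, cos_zen, PiLp.inner_apply,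
    Fin.sum_univ_three]
  simp only [RCLike.inner_apply, conj_trivial]
  ring

theorem azimuth_azi_zen (η ξ : S2) :
    azimuth (azi η.1.ofLp) (zen η) ξ =
      ((Complex.arg ⟨frame η ξ.1 0, frame η ξ.1 1⟩ : ℝ) : Torus) := rfl

/-- Only the zenith and its antipode project to zero in the plane orthogonal to the zenith. -/
theorem eq_or_eq_neg_of_frame_eq_zero {η ξ : S2} (h0 : frame η ξ.1 0 = 0)
    (h1 : frame η ξ.1 1 = 0) : ξ = η ∨ ξ = -η := by
  have hξ : ‖ξ.1‖ = 1 := norm_eq_of_mem_sphere ξ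
  have hη : ‖η.1‖ = 1 := norm_eq_of_mem_sphere η
  have h := frame_dotProduct η ξ.1 ξ.1
  rw [h0, h1, frame_two, real_inner_self_eq_norm_sq, hξ] at h
  have h2 : inner ℝ η.1 ξ.1 = 1 ∨ inner ℝ η.1 ξ.1 = -1 :=
    mul_self_eq_one_iff.1 (by linarith)
  rcases h2 with h2 | h2
  · exact Or.inl (Subtype.ext ((inner_eq_one_iff_of_norm_eq_one hη hξ).1 h2).symm)
  · refine Or.inr (Subtype.ext ?_)
    have h3 : inner ℝ (-η.1) ξ.1 = 1 := by rw [inner_neg_left, h2, neg_neg]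
    exact ((inner_eq_one_iff_of_norm_eq_one (by rwa [norm_neg]) hξ).1 h3).symm

/-! ### Continuity in the zenith -/

theorem continuousAt_azi {x : Fin 3 → ℝ} (hx : ¬(x 0 = 0 ∧ x 1 = 0)) : ContinuousAt azi x := by
  have hne : (⟨x 0, x 1⟩ : ℂ) ≠ 0 := fun h => hx ⟨congrArg Complex.re h, congrArg Complex.im h⟩
  have hc : Continuous fun x : Fin 3 → ℝ => Complex.equivRealProdCLM.symm (x 0, x 1) := by fun_prop
  exact ContinuousAt.comp (f := fun x : Fin 3 → ℝ => Complex.equivRealProdCLM.symm (x 0, x 1))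
    (Complex.continuousAt_arg_coe_angle hne) hc.continuousAt

theorem continuous_eul : Continuous fun z : Torus × ℝ => eul z.1 z.2 0 := by
  have hc := continuous_cosT
  have hs := continuous_sinT
  have h3 : Continuous fun z : Torus × ℝ => R3 z.1 := by
    refine continuous_matrix fun i j => ?_
    fin_cases i <;> fin_cases j <;> simp [R3] <;> fun_prop
  have h2 : Continuous fun z : Torus × ℝ => R2 z.2 := by
    refine continuous_matrix fun i j => ?_
    fin_cases i <;> fin_cases j <;> simp [R2] <;> fun_prop
  exact (h3.matrix_mul h2).matrix_mul continuous_const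

theorem continuousAt_azimuth {η ξ : S2} (hη : ¬(η.1 0 = 0 ∧ η.1 1 = 0)) (h1 : ξ ≠ η)
    (h2 : ξ ≠ -η) : ContinuousAt (fun η : S2 => azimuth (azi η.1.ofLp) (zen η) ξ) η := by
  have hz : Continuous zen := by
    unfold zen
    fun_prop
  have ha : ContinuousAt (fun η : S2 => azi η.1.ofLp) η :=
    ContinuousAt.comp (g := azi) (f := fun η : S2 => η.1.ofLp) (continuousAt_azi hη)
      (by fun_prop : Continuous fun η : S2 => η.1.ofLp).continuousAt
  have hm : ContinuousAt (fun η : S2 => eul (azi η.1.ofLp) (zen η) 0) η :=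
    ContinuousAt.comp (g := fun z : Torus × ℝ => eul z.1 z.2 0)
      (f := fun η : S2 => (azi η.1.ofLp, zen η)) continuous_eul.continuousAt
      (ha.prodMk hz.continuousAt)
  have hmul : Continuous fun M : Matrix (Fin 3) (Fin 3) ℝ => M.transpose.mulVec ξ.1.ofLp := by
    fun_prop
  have hf : ContinuousAt (fun η : S2 => frame η ξ.1) η :=
    ContinuousAt.comp (g := fun M : Matrix (Fin 3) (Fin 3) ℝ => M.transpose.mulVec ξ.1.ofLp)
      (f := fun η : S2 => eul (azi η.1.ofLp) (zen η) 0) hmul.continuousAt hm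
  refine ContinuousAt.comp (g := azi) (f := fun η : S2 => frame η ξ.1) (continuousAt_azi ?_) hf
  rintro ⟨h3, h4⟩
  rcases eq_or_eq_neg_of_frame_eq_zero h3 h4 with h | h
  exacts [h1 h, h2 h]

/-- The zeniths at which the frame jumps or at which an atom of one of the measures sits at the
zenith or its antipode. -/
def exceptional (μ ν : Measure S2) : Set S2 :=
  {η | (η.1 0 = 0 ∧ η.1 1 = 0) ∨ (μ {η} ≠ 0 ∨ μ {-η} ≠ 0) ∨ (ν {η} ≠ 0 ∨ ν {-η} ≠ 0)}

theorem countable_setOf_measure_singleton_ne_zero (μ : Measure S2) [IsFiniteMeasure μ] :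
    {η | μ {η} ≠ 0}.Countable := by
  simpa only [pos_iff_ne_zero] using Measure.countable_meas_pos_of_disjoint_iUnion (μ := μ)
    (As := fun η : S2 => {η}) (fun η => measurableSet_singleton η)
    fun _ _ h => disjoint_singleton.2 h

theorem countable_exceptional (μ ν : Measure S2) [IsFiniteMeasure μ] [IsFiniteMeasure ν] :
    (exceptional μ ν).Countable := by
  have hneg : ∀ (μ : Measure S2) [IsFiniteMeasure μ],
      {η | μ {η} ≠ 0 ∨ μ {-η} ≠ 0}.Countable := fun μ _ =>
    (countable_setOf_measure_singleton_ne_zero μ).union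
      ((countable_setOf_measure_singleton_ne_zero μ).preimage neg_injective)
  refine Set.Countable.union ?_ ((hneg μ).union (hneg ν))
  have hsub : {η : S2 | η.1 0 = 0 ∧ η.1 1 = 0} ⊆
      {S2.mk 0 0 1 (by norm_num), S2.mk 0 0 (-1) (by norm_num)} := by
    rintro η ⟨h0, h1⟩
    have h := S2.sq_sum η
    rw [h0, h1] at h
    have h2 : η.1 2 = 1 ∨ η.1 2 = -1 := mul_self_eq_one_iff.1 (by linarith)
    rcases h2 with h2 | h2
    · refine Or.inl (Subtype.ext (PiLp.ext fun i => ?_))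
      fin_cases i
      exacts [h0, h1, h2]
    · refine Or.inr (Subtype.ext (PiLp.ext fun i => ?_))
      fin_cases i
      exacts [h0, h1, h2]
  exact (Set.toFinite _).countable.mono hsub

theorem continuousAt_semicircleDist {p : ℝ} (hp : 1 ≤ p) {μ ν : Measure S2}
    [IsProbabilityMeasure μ] [IsProbabilityMeasure ν] {η : S2} (hη : η ∉ exceptional μ ν) :
    ContinuousAt (semicircleDist p μ ν) η := by
  simp only [exceptional, mem_ofPred_eq, not_or, not_ne_iff] at hη
  obtain ⟨hpole, ⟨hμ₁, hμ₂⟩, hν₁, hν₂⟩ := hη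
  have key : ∀ μ : Measure S2, μ {η} = 0 → μ {-η} = 0 →
      ∀ᵐ ξ ∂μ, ContinuousAt (fun η : S2 => azimuth (azi η.1.ofLp) (zen η) ξ) η := by
    intro μ h1 h2
    filter_upwards [compl_mem_ae_iff.2 h1, compl_mem_ae_iff.2 h2] with ξ hξ₁ hξ₂
    exact continuousAt_azimuth hpole hξ₁ hξ₂
  exact continuousAt_wasserstein_map hp μ ν
    (f := fun η : S2 => azimuth (azi η.1.ofLp) (zen η)) (fun η => measurable_azimuth _ _)
    (key μ hμ₁ hμ₂) (key ν hν₁ hν₂)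

theorem aemeasurable_semicircleDist {p : ℝ} (hp : 1 ≤ p) (μ ν : Measure S2)
    [IsProbabilityMeasure μ] [IsProbabilityMeasure ν] :
    AEMeasurable (semicircleDist p μ ν) surfaceMeasure := by
  have hE := countable_exceptional μ ν
  have hc : ContinuousOn (semicircleDist p μ ν) (exceptional μ ν)ᶜ :=
    fun η hη => (continuousAt_semicircleDist hp hη).continuousWithinAt
  have h := hc.aemeasurable (μ := surfaceMeasure) hE.measurableSet.compl
  have hres : surfaceMeasure.restrict (exceptional μ ν)ᶜ = surfaceMeasure :=
    Measure.restrict_eq_self_of_ae_mem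
      (measure_eq_zero_iff_ae_notMem.1 (hE.measure_zero surfaceMeasure))
  rwa [hres] at h

instance isProbabilityMeasure_semicircle (α : Torus) (β : ℝ) (μ : Measure S2)
    [IsProbabilityMeasure μ] : IsProbabilityMeasure (semicircle α β μ) :=
  Measure.isProbabilityMeasure_map (measurable_azimuth α β).aemeasurable

/-- By continuity at `η` and since neighbourhoods of `η` have positive surface measure, equality
of almost all slices is inherited by every non-exceptional slice. -/
theorem semicircle_eq_of_semicircleDist_ae_eq_zero {p : ℝ} (hp : 1 ≤ p) {μ ν : Measure S2}
    [IsProbabilityMeasure μ] [IsProbabilityMeasure ν]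
    (h : ∀ᵐ η ∂surfaceMeasure, semicircleDist p μ ν η = 0) {η : S2}
    (hη : η ∉ exceptional μ ν) :
    semicircle (azi η.1.ofLp) (zen η) μ = semicircle (azi η.1.ofLp) (zen η) ν := by
  refine eq_of_wasserstein_eq_zero (p := p) (by linarith) ?_
  by_contra hne
  exact surfaceMeasure_ne_zero_of_mem_nhds (fun hp => hη (Or.inl hp))
    ((continuousAt_semicircleDist hp hη).eventually_ne hne) h

/-! ### The moment problem on a compact interval -/

/-- Finite measures on a compact interval are determined by their moments. -/
theorem ext_of_integral_pow_eq {a b : ℝ} {m n : Measure (Icc a b)} [IsFiniteMeasure m]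
    [IsFiniteMeasure n] (h : ∀ k : ℕ, ∫ x, (x : ℝ) ^ k ∂m = ∫ x, (x : ℝ) ^ k ∂n) : m = n := by
  have hint : ∀ (m : Measure (Icc a b)) [IsFiniteMeasure m] (f : C(Icc a b, ℝ)),
      Integrable f m := fun m _ f => f.continuous.integrable_of_hasCompactSupport
        (HasCompactSupport.of_compactSpace _)
  have hpoly : ∀ f ∈ polynomialFunctions (Icc a b), ∫ x, f x ∂m = ∫ x, f x ∂n := by
    rintro _ ⟨q, -, rfl⟩
    have key : ∀ (m : Measure (Icc a b)) [IsFiniteMeasure m],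
        ∫ x : Icc a b, q.eval (x : ℝ) ∂m =
          ∑ k ∈ Finset.range (q.natDegree + 1), q.coeff k * ∫ x : Icc a b, (x : ℝ) ^ k ∂m := by
      intro m _
      simp only [Polynomial.eval_eq_sum_range, ← integral_const_mul]
      refine integral_finsetSum _ fun k _ => ?_
      exact hint m ⟨fun x : Icc a b => q.coeff k * (x : ℝ) ^ k, by fun_prop⟩
    exact (key m).trans ((Finset.sum_congr rfl fun k _ => by rw [h k]).trans (key n).symm)
  have hcont : ∀ (m : Measure (Icc a b)) [IsFiniteMeasure m],
      Continuous fun f : C(Icc a b, ℝ) => ∫ x, f x ∂m := by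
    intro m _
    refine (LipschitzWith.of_dist_le_mul (K := (m.real univ).toNNReal) fun f g => ?_).continuous
    rw [dist_eq_norm, ← integral_sub (hint m f) (hint m g),
      Real.coe_toNNReal _ measureReal_nonneg, mul_comm]
    exact norm_integral_le_of_norm_le_const
      (ae_of_all _ fun x => (dist_eq_norm (f x) (g x)).symm.trans_le (f.dist_apply_le_dist x))
  have hall : ∀ f : C(Icc a b, ℝ), ∫ x, f x ∂m = ∫ x, f x ∂n := by
    intro f
    have hf : f ∈ (polynomialFunctions (Icc a b)).topologicalClosure := by
      rw [polynomialFunctions_closure_eq_top]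
      trivial
    exact closure_minimal hpoly (isClosed_eq (hcont m) (hcont n)) hf
  exact ext_of_forall_integral_eq_of_IsFiniteMeasure fun f => hall f.toContinuousMap

/-! ### Injectivity of the semicircle transform -/

/-- A function of two linear forms vanishing at the zenith that is homogeneous of degree zero is a
function of the azimuth, away from the zenith and its antipode. -/
theorem integral_comp_inner_inner_eq {μ ν : Measure S2} {η : S2} (hη : η ∉ exceptional μ ν)
    (h : semicircle (azi η.1.ofLp) (zen η) μ = semicircle (azi η.1.ofLp) (zen η) ν)
    {a c : EuclideanSpace ℝ (Fin 3)} (ha : inner ℝ η.1 a = 0) (hc : inner ℝ η.1 c = 0)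
    {G : ℝ → ℝ → ℂ} (hG : Measurable (Function.uncurry G))
    (hom : ∀ r x y, 0 < r → G (r * x) (r * y) = G x y) :
    ∫ ξ : S2, G (inner ℝ ξ.1 a) (inner ℝ ξ.1 c) ∂μ =
      ∫ ξ : S2, G (inner ℝ ξ.1 a) (inner ℝ ξ.1 c) ∂ν := by
  simp only [exceptional, mem_ofPred_eq, not_or, not_ne_iff] at hη
  obtain ⟨-, ⟨hμ₁, hμ₂⟩, hν₁, hν₂⟩ := hη
  set g : Torus → ℂ := fun θ => G (cosT θ * frame η a 0 + sinT θ * frame η a 1)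
    (cosT θ * frame η c 0 + sinT θ * frame η c 1) with hg
  have hgm : Measurable g := by
    have h1 := continuous_cosT
    have h2 := continuous_sinT
    have h3 : Measurable fun θ => (cosT θ * frame η a 0 + sinT θ * frame η a 1,
        cosT θ * frame η c 0 + sinT θ * frame η c 1) := Continuous.measurable (by fun_prop)
    exact hG.comp h3
  have hpt : ∀ ξ : S2, ξ ≠ η → ξ ≠ -η →
      G (inner ℝ ξ.1 a) (inner ℝ ξ.1 c) = g (azimuth (azi η.1.ofLp) (zen η) ξ) := by
    intro ξ h1 h2
    set z : ℂ := ⟨frame η ξ.1 0, frame η ξ.1 1⟩ with hz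
    have hz0 : z ≠ 0 := fun h => by
      rcases eq_or_eq_neg_of_frame_eq_zero (congrArg Complex.re h) (congrArg Complex.im h)
        with h | h
      exacts [h1 h, h2 h]
    have hcos : ‖z‖ * cosT (z.arg : ℝ) = frame η ξ.1 0 := Complex.norm_mul_cos_arg z
    have hsin : ‖z‖ * sinT (z.arg : ℝ) = frame η ξ.1 1 := Complex.norm_mul_sin_arg z
    have hinner : ∀ b, inner ℝ η.1 b = 0 → inner ℝ ξ.1 b =
        ‖z‖ * (cosT (z.arg : ℝ) * frame η b 0 + sinT (z.arg : ℝ) * frame η b 1) := by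
      intro b hb
      rw [← frame_dotProduct η ξ.1 b, frame_two η b, hb, ← hcos, ← hsin]
      ring
    rw [hinner a ha, hinner c hc, hom _ _ _ (norm_pos_iff.2 hz0), azimuth_azi_zen]
  have key : ∀ μ : Measure S2, μ {η} = 0 → μ {-η} = 0 →
      ∫ ξ : S2, G (inner ℝ ξ.1 a) (inner ℝ ξ.1 c) ∂μ =
        ∫ θ, g θ ∂semicircle (azi η.1.ofLp) (zen η) μ := by
    intro μ h1 h2
    rw [semicircle, integral_map (measurable_azimuth _ _).aemeasurable
      hgm.aestronglyMeasurable]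
    refine integral_congr_ae ?_
    filter_upwards [compl_mem_ae_iff.2 h1, compl_mem_ae_iff.2 h2] with ξ hξ₁ hξ₂
    exact hpt ξ hξ₁ hξ₂
  rw [key μ hμ₁ hμ₂, key ν hν₁ hν₂, h]

theorem stdGaussian_setOf_inner_eq_zero (η : S2) :
    stdGaussian (EuclideanSpace ℝ (Fin 3)) {a | inner ℝ η.1 a = 0} = 0 := by
  have hmap := IsGaussian.map_eq_gaussianReal (μ := stdGaussian (EuclideanSpace ℝ (Fin 3)))
    (innerSL ℝ η.1)
  rw [variance_dual_stdGaussian, innerSL_apply_norm, norm_eq_of_mem_sphere η] at hmap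
  have : NullSingletonClass (gaussianReal ((stdGaussian (EuclideanSpace ℝ (Fin 3)))[innerSL ℝ η.1])
      (Real.toNNReal (1 ^ 2))) := nullSingletonClass_gaussianReal (by simp)
  have h0 := measure_singleton (μ := gaussianReal
    ((stdGaussian (EuclideanSpace ℝ (Fin 3)))[innerSL ℝ η.1]) (Real.toNNReal (1 ^ 2))) 0
  rw [← hmap, Measure.map_apply (by fun_prop) (measurableSet_singleton 0)] at h0
  exact h0

/-- Two vectors of `ℝ³`, even if linearly dependent, have a common orthogonal unit vector. -/
theorem exists_S2_inner_eq_zero (a c : EuclideanSpace ℝ (Fin 3)) :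
    ∃ η : S2, inner ℝ η.1 a = 0 ∧ inner ℝ η.1 c = 0 := by
  set T : EuclideanSpace ℝ (Fin 3) →ₗ[ℝ] ℝ × ℝ :=
    ((innerSL ℝ a).prod (innerSL ℝ c)).toLinearMap with hT
  have hker : LinearMap.ker T ≠ ⊥ := LinearMap.ker_ne_bot_of_finrank_lt (by simp)
  obtain ⟨v, hv, hv0⟩ := Submodule.exists_mem_ne_zero_of_ne_bot hker
  have hv' : inner ℝ a v = 0 ∧ inner ℝ c v = 0 := by
    simpa [hT, Prod.ext_iff] using hv
  refine ⟨⟨‖v‖⁻¹ • v, ?_⟩, ?_, ?_⟩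
  · rw [mem_sphere_zero_iff_norm, norm_smul, norm_inv, norm_norm,
      inv_mul_cancel₀ (norm_ne_zero_iff.2 hv0)]
  · simp [inner_smul_left, real_inner_comm, hv'.1]
  · simp [inner_smul_left, real_inner_comm, hv'.2]

/-- `exp (i s x / y)` on the half-plane `y > 0`, a function that is homogeneous of degree zero. -/
noncomputable def expRatio (s x y : ℝ) : ℂ :=
  if 0 < y then Complex.exp ((s * (x / y) : ℝ) * Complex.I) else 0

theorem measurable_expRatio (s : ℝ) : Measurable (Function.uncurry (expRatio s)) := by
  unfold expRatio Function.uncurry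
  exact Measurable.ite (measurableSet_lt measurable_const measurable_snd) (by fun_prop)
    measurable_const

theorem norm_expRatio_le (s x y : ℝ) : ‖expRatio s x y‖ ≤ 1 := by
  unfold expRatio
  split_ifs
  · rw [Complex.norm_exp_ofReal_mul_I]
  · simp

theorem expRatio_homogeneous (s r x y : ℝ) (hr : 0 < r) :
    expRatio s (r * x) (r * y) = expRatio s x y := by
  simp only [expRatio, mul_pos_iff_of_pos_left hr, mul_div_mul_left x y hr.ne']

/-- The Gaussian average of `exp (i s ⟨ξ, a⟩ / y)` over `a` is a characteristic function. -/
theorem integral_expRatio_stdGaussian (s y : ℝ) (ξ : S2) :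
    ∫ a, expRatio s (inner ℝ ξ.1 a) y ∂stdGaussian (EuclideanSpace ℝ (Fin 3)) =
      if 0 < y then ((Real.exp (-(s / y) ^ 2 / 2) : ℝ) : ℂ) else 0 := by
  unfold expRatio
  split_ifs with hy
  · have h := charFun_stdGaussian ((s / y) • ξ.1)
    rw [charFun_apply, norm_smul, norm_eq_of_mem_sphere ξ, mul_one, Real.norm_eq_abs] at h
    have h2 : ∀ a, s * (inner ℝ ξ.1 a / y) = inner ℝ a ((s / y) • ξ.1) := by
      intro a
      rw [inner_smul_right, real_inner_comm]
      ring
    simp only [h2]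
    rw [h, ← Complex.ofReal_pow, sq_abs]
    push_cast
    rfl
  · simp

section Injectivity

variable {μ ν : Measure S2} [IsProbabilityMeasure μ] [IsProbabilityMeasure ν]

/-- Almost every Gaussian vector `a` admits a non-exceptional zenith orthogonal to `a` and `c`, so
the integrals of `expRatio s ⟨ξ, a⟩ ⟨ξ, c⟩` agree; average them over `a`. -/
theorem integral_exp_neg_div_sq_eq
    (h : ∀ η : S2, η ∉ exceptional μ ν →
      semicircle (azi η.1.ofLp) (zen η) μ = semicircle (azi η.1.ofLp) (zen η) ν)
    (c : EuclideanSpace ℝ (Fin 3)) (s : ℝ) :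
    ∫ ξ in {ξ : S2 | 0 < inner ℝ ξ.1 c}, Real.exp (-(s / inner ℝ ξ.1 c) ^ 2 / 2) ∂μ =
      ∫ ξ in {ξ : S2 | 0 < inner ℝ ξ.1 c}, Real.exp (-(s / inner ℝ ξ.1 c) ^ 2 / 2) ∂ν := by
  set γ := stdGaussian (EuclideanSpace ℝ (Fin 3))
  have hE : ∀ᵐ a ∂γ, ∀ η ∈ exceptional μ ν, inner ℝ η.1 a ≠ 0 :=
    (ae_ball_iff (countable_exceptional μ ν)).2 fun η _ =>
      measure_eq_zero_iff_ae_notMem.1 (stdGaussian_setOf_inner_eq_zero η)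
  have hae : ∀ᵐ a ∂γ, ∫ ξ : S2, expRatio s (inner ℝ ξ.1 a) (inner ℝ ξ.1 c) ∂μ =
      ∫ ξ : S2, expRatio s (inner ℝ ξ.1 a) (inner ℝ ξ.1 c) ∂ν := by
    filter_upwards [hE] with a ha
    obtain ⟨η, h1, h2⟩ := exists_S2_inner_eq_zero a c
    have hη : η ∉ exceptional μ ν := fun hη => ha η hη h1
    exact integral_comp_inner_inner_eq hη (h η hη) h1 h2 (measurable_expRatio s)
      (expRatio_homogeneous s)
  have hS : MeasurableSet {ξ : S2 | 0 < inner ℝ ξ.1 c} :=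
    measurableSet_lt measurable_const (by fun_prop)
  have key : ∀ (μ : Measure S2) [IsProbabilityMeasure μ],
      ((∫ ξ in {ξ : S2 | 0 < inner ℝ ξ.1 c}, Real.exp (-(s / inner ℝ ξ.1 c) ^ 2 / 2) ∂μ : ℝ) : ℂ) =
        ∫ a, ∫ ξ : S2, expRatio s (inner ℝ ξ.1 a) (inner ℝ ξ.1 c) ∂μ ∂γ := by
    intro μ _
    have hm : Measurable fun z : EuclideanSpace ℝ (Fin 3) × S2 =>
        expRatio s (inner ℝ z.2.1 z.1) (inner ℝ z.2.1 c) := by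
      have h3 : Measurable fun z : EuclideanSpace ℝ (Fin 3) × S2 =>
          (inner ℝ z.2.1 z.1, inner ℝ z.2.1 c) := Continuous.measurable (by fun_prop)
      exact (measurable_expRatio s).comp h3
    rw [integral_integral_swap ((integrable_const (1 : ℝ)).mono' hm.aestronglyMeasurable
      (ae_of_all _ fun z => norm_expRatio_le _ _ _)), ← integral_complex_ofReal,
      ← integral_indicator hS]
    refine integral_congr_ae (ae_of_all _ fun ξ => ?_)
    simp only [γ, integral_expRatio_stdGaussian, indicator_apply, mem_ofPred_eq]
  exact_mod_cast (key μ).trans ((integral_congr_ae hae).trans (key ν).symm)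

/-- The integrals of `exp (-n / y²)`, `y = ⟨ξ, c⟩ > 0`, are the moments of `exp (-1 / y²)`, whose
law determines the law of `y`. -/
theorem setIntegral_comp_inner_eq
    (h : ∀ η : S2, η ∉ exceptional μ ν →
      semicircle (azi η.1.ofLp) (zen η) μ = semicircle (azi η.1.ofLp) (zen η) ν)
    (c : EuclideanSpace ℝ (Fin 3)) {φ : ℝ → ℂ} (hφ : Measurable φ) :
    ∫ ξ in {ξ : S2 | 0 < inner ℝ ξ.1 c}, φ (inner ℝ ξ.1 c) ∂μ =
      ∫ ξ in {ξ : S2 | 0 < inner ℝ ξ.1 c}, φ (inner ℝ ξ.1 c) ∂ν := by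
  have hS : MeasurableSet {ξ : S2 | 0 < inner ℝ ξ.1 c} :=
    measurableSet_lt measurable_const (by fun_prop)
  set V : S2 → Icc (0 : ℝ) 1 := fun ξ => ⟨Real.exp (-(1 / inner ℝ ξ.1 c) ^ 2),
    (Real.exp_pos _).le, Real.exp_le_one_iff.2 (neg_nonpos.2 (sq_nonneg _))⟩ with hV
  have hVm : Measurable V := by
    have h1 : Measurable fun ξ : S2 => inner ℝ ξ.1 c := Continuous.measurable (by fun_prop)
    exact Measurable.subtype_mk (by fun_prop)
  have hmap : (μ.restrict {ξ : S2 | 0 < inner ℝ ξ.1 c}).map V =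
      (ν.restrict {ξ : S2 | 0 < inner ℝ ξ.1 c}).map V := by
    refine ext_of_integral_pow_eq fun k => ?_
    rw [integral_map hVm.aemeasurable (by fun_prop), integral_map hVm.aemeasurable (by fun_prop)]
    -- `s = √(2k)` turns `exp (-(s / y)² / 2)` into the `k`-th power of `exp (-1 / y²)`
    have hpow : ∀ ξ : S2, (V ξ : ℝ) ^ k = Real.exp (-(√(2 * k) / inner ℝ ξ.1 c) ^ 2 / 2) := by
      intro ξ
      rw [hV, ← Real.exp_nat_mul, div_pow √(2 * k), Real.sq_sqrt (by positivity)]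
      ring_nf
    simp only [hpow]
    exact integral_exp_neg_div_sq_eq h c _
  have hψm : Measurable fun v : Icc (0 : ℝ) 1 => φ (1 / √(-Real.log v)) := by fun_prop
  have key : ∀ μ : Measure S2, ∫ ξ in {ξ : S2 | 0 < inner ℝ ξ.1 c}, φ (inner ℝ ξ.1 c) ∂μ =
      ∫ v, φ (1 / √(-Real.log v)) ∂(μ.restrict {ξ : S2 | 0 < inner ℝ ξ.1 c}).map V := by
    intro μ
    rw [integral_map hVm.aemeasurable hψm.aestronglyMeasurable]
    refine setIntegral_congr_fun hS fun ξ (hξ : 0 < inner ℝ ξ.1 c) => ?_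
    simp only [hV, Real.log_exp, neg_neg, Real.sqrt_sq (one_div_pos.2 hξ).le, one_div_one_div]
  rw [key, key, hmap]

/-- Splitting `exp (i ⟨ξ, t⟩) - 1` according to the sign of `⟨ξ, t⟩` expresses the characteristic
function through the laws of `⟨ξ, t⟩` and `⟨ξ, -t⟩` on the positive half-line. -/
theorem eq_of_semicircle_eq
    (h : ∀ η : S2, η ∉ exceptional μ ν →
      semicircle (azi η.1.ofLp) (zen η) μ = semicircle (azi η.1.ofLp) (zen η) ν) : μ = ν := by
  refine eq_of_forall_integral_exp_inner_eq fun t => ?_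
  set φ : ℝ → ℝ → ℂ := fun r y => Complex.exp ((r * y : ℝ) * Complex.I) - 1 with hφ
  have hS : ∀ c, MeasurableSet {ξ : S2 | 0 < inner ℝ ξ.1 c} := fun c =>
    measurableSet_lt measurable_const (by fun_prop)
  have hφm : ∀ r, Measurable (φ r) := fun r => by fun_prop
  have hint : ∀ (μ : Measure S2) [IsProbabilityMeasure μ] (r : ℝ) (c : EuclideanSpace ℝ (Fin 3)),
      Integrable ({ξ : S2 | 0 < inner ℝ ξ.1 c}.indicator fun ξ => φ r (inner ℝ ξ.1 c)) μ := by
    intro μ _ r c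
    refine Integrable.indicator ?_ (hS c)
    refine (integrable_const (2 : ℝ)).mono' (by fun_prop) (ae_of_all _ fun ξ => ?_)
    refine (norm_sub_le _ _).trans ?_
    rw [Complex.norm_exp_ofReal_mul_I, norm_one]
    norm_num
  have key : ∀ (μ : Measure S2) [IsProbabilityMeasure μ],
      ∫ ξ : S2, Complex.exp (inner ℝ ξ.1 t * Complex.I) ∂μ =
        1 + (∫ ξ in {ξ : S2 | 0 < inner ℝ ξ.1 t}, φ 1 (inner ℝ ξ.1 t) ∂μ +
          ∫ ξ in {ξ : S2 | 0 < inner ℝ ξ.1 (-t)}, φ (-1) (inner ℝ ξ.1 (-t)) ∂μ) := by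
    intro μ _
    rw [← integral_indicator (hS t), ← integral_indicator (hS (-t)),
      ← integral_add' (hint μ _ _) (hint μ _ _)]
    have h1 : (1 : ℂ) = ∫ _ : S2, (1 : ℂ) ∂μ := by simp
    rw [h1, ← integral_add (integrable_const _) ((hint μ _ _).add (hint μ _ _))]
    refine integral_congr_ae (ae_of_all _ fun ξ => ?_)
    simp only [Pi.add_apply, indicator_apply, mem_ofPred_eq, inner_neg_right, Left.neg_pos_iff, hφ]
    rcases lt_trichotomy (inner ℝ ξ.1 t) 0 with h0 | h0 | h0
    · simp [h0, h0.not_gt]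
    · simp [h0]
    · simp [h0, h0.not_gt]
  rw [key, key, setIntegral_comp_inner_eq h t (hφm 1), setIntegral_comp_inner_eq h (-t) (hφm (-1))]

end Injectivity

theorem isMetric_SSW {p : ℝ} (hp : 1 ≤ p) :
    IsMetric fun μ ν : ProbabilityMeasure S2 => SSW p (μ : Measure S2) (ν : Measure S2) := by
  have hp0 : 0 < p := by linarith
  exact isMetric_lintegral_rpow hp
    (w := fun η (μ ν : ProbabilityMeasure S2) =>
      semicircleDist p (μ : Measure S2) (ν : Measure S2) η)
    (isCompact_univ (X := Torus)).isBounded.ediam_ne_top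
    (fun η μ ν => wasserstein_le_diam hp0 _ _) (fun η μ => wasserstein_self hp0 _)
    (fun η μ ν => wasserstein_symm hp0 _ _) (fun η μ ν ρ => wasserstein_triangle hp _ _ _)
    (fun μ ν => aemeasurable_semicircleDist hp _ _) fun μ ν h => Subtype.ext
      (eq_of_semicircle_eq (μ := (μ : Measure S2)) (ν := (ν : Measure S2)) fun η hη =>
        semicircle_eq_of_semicircleDist_ae_eq_zero hp h hη)

end SphereOT

open SphereOT

theorem mainTheorem1 (p : ℝ) (hp : 1 ≤ p) :
    ((∀ μ ν : ProbabilityMeasure S2,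
        AEMeasurable (fun ψ : Torus =>
          wasserstein p (verticalSlice ψ (μ : Measure S2)) (verticalSlice ψ (ν : Measure S2)) ^ p)
          volume) ∧
      IsMetric fun μ ν : {μ : ProbabilityMeasure S2 // IsEven μ} =>
        VSW p (μ.1 : Measure S2) (ν.1 : Measure S2)) ∧
    ((∀ μ ν : ProbabilityMeasure S2,
        AEMeasurable (fun η : S2 =>
          semicircleDist p (μ : Measure S2) (ν : Measure S2) η ^ p) surfaceMeasure) ∧
      IsMetric fun μ ν : ProbabilityMeasure S2 =>
        SSW p (μ : Measure S2) (ν : Measure S2)) :=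
  ⟨⟨fun _ _ => (continuous_wasserstein_verticalSlice hp _ _).aemeasurable.pow_const p,
      isMetric_VSW hp⟩,
    fun _ _ => (aemeasurable_semicircleDist hp _ _).pow_const p, isMetric_SSW hp⟩
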